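/- Fix a universal, additively optimal binary machine $U$: a partial computable function $(P,y)\mapsto U(P,y)$ on pairs of binary strings such that every program of every such machine $V$ is equivalent to some program of $U$, and such that for every $V$ there is a constant $c$ with: whenever $V(P,y)=x$, some $Q$ of length $l(Q)\le l(P)+c$ has $U(Q,y)=x$. Let $C(x\mid y)$ be the length of a shortest $P$ with $U(P,y)=x$, and $C(x)=C(x\mid\epsilon)$, with natural numbers identified with binary strings in the usual way ($0,1,2,3,\dots\leftrightarrow\epsilon,0,1,00,\dots$). For a real $\alpha$ let $\alpha_n$ be the string of the first $n$ binary digits of $\alpha$ (after the binary point), and let $C_{\beta,n}=C(C(\beta_n)\mid\beta_n)$. A real is left c.e. if it is the limit of a computable nondecreasing sequence of rationals; a program $P_\alpha$ for $\alpha$ is a program for $U$ that outputs the $s$-th term of such a sequence on input $s$. (1) There is a computable function $D:\mathbb N^2\to\mathbb N$ such that for all left c.e. reals $\alpha,\beta$ with programs $P_\alpha,P_\beta$ the following holds with $d=D(l(P_\alpha),l(P_\beta))$: if $C(\alpha_n\mid\beta_n)\le C_{\beta,n}+d$ for all $n$, then $\alpha$ is computable in $\beta$ (that is, the digit sequence of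 $\alpha$ is Turing reducible to that of $\beta$). (2) The hypothesis $C(\alpha_n\mid\beta_n)=O(1)$ of the Downey–Hirschfeldt–LaForte theorem can be weakened: for all left c.e. reals $\alpha,\beta$, if there is a constant $d\in\mathbb N$ with $C(\alpha_n\mid\beta_n)\le C_{\beta,n}+d$ for all $n$, then $\alpha$ is computable in $\beta$. -/

import Mathlib

/-- The Li–Vitányi identification of natural numbers with binary strings:
`0 ↦ ε, 1 ↦ 0, 2 ↦ 1, 3 ↦ 00, 4 ↦ 01, …` (the binary expansion of `n + 1` without its leading
`1`). -/
def natStr (n : ℕ) : List Bool := (Nat.bits (n + 1)).dropLast.reverse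

/-- `U p y` is the (possibly undefined) output of the machine on program `p` with side input `y`.
`U` is universal: every program of every machine is equivalent to some program of `U`. It is
additively optimal: compared with any other machine, it loses at most a constant in the length of
a shortest program. -/
structure IsUniversalOptimal (U : List Bool → List Bool →. List Bool) : Prop where
  partrec : Partrec₂ U
  universal : ∀ V : List Bool → List Bool →. List Bool, Partrec₂ V →
    ∀ p, ∃ q, ∀ y, U q y = V p y
  optimal : ∀ V : List Bool → List Bool →. List Bool, Partrec₂ V →
    ∃ c : ℕ, ∀ p y x, x ∈ V p y → ∃ q, x ∈ U q y ∧ q.length ≤ p.length + c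

/-- Conditional Kolmogorov complexity `C(x | y)` with respect to `U`. -/
noncomputable def condC (U : List Bool → List Bool →. List Bool) (x y : List Bool) : ℕ :=
  sInf {l | ∃ p : List Bool, x ∈ U p y ∧ p.length = l}

/-- Plain Kolmogorov complexity `C(x) = C(x | ε)`. -/
noncomputable def plainC (U : List Bool → List Bool →. List Bool) (x : List Bool) : ℕ :=
  condC U x []

/-- The `i`-th digit (counting from `0`) after the binary point of the real `α`. -/
noncomputable def binDigit (α : ℝ) (i : ℕ) : Bool := decide (⌊α * 2 ^ (i + 1)⌋ % 2 = 1)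

/-- `α_n`: the string of the first `n` binary digits of `α`. -/
noncomputable def initSeg (α : ℝ) (n : ℕ) : List Bool := (List.range n).map (binDigit α)

/-- `C_{β,n} = C(C(β_n) | β_n)`. -/
noncomputable def withheldC (U : List Bool → List Bool →. List Bool) (β : ℝ) (n : ℕ) : ℕ :=
  condC U (natStr (plainC U (initSeg β n))) (initSeg β n)

/-- A standard numbering of the rationals: `⟨⟨a, b⟩, c⟩ ↦ (a - b) / (c + 1)`. -/
def ratOfNat (m : ℕ) : ℚ :=
  ((m.unpair.1.unpair.1 : ℚ) - (m.unpair.1.unpair.2 : ℚ)) / ((m.unpair.2 : ℚ) + 1)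

/-- `f` lists (codes of) a nondecreasing sequence of rationals with limit `α`. -/
def ApproxFromBelow (f : ℕ → ℕ) (α : ℝ) : Prop :=
  Monotone (fun s => ratOfNat (f s)) ∧
    Filter.Tendsto (fun s => ((ratOfNat (f s) : ℚ) : ℝ)) Filter.atTop (nhds α)

/-- `α` is a left c.e. real: the limit of a computable nondecreasing sequence of rationals. -/
def IsLeftCE (α : ℝ) : Prop := ∃ f : ℕ → ℕ, Computable f ∧ ApproxFromBelow f α

/-- `P` is a program (for `U`) for the left c.e. real `α`: on input `s` it outputs the `s`-th term
of a nondecreasing sequence of rationals with limit `α`. -/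
def IsProgramFor (U : List Bool → List Bool →. List Bool) (P : List Bool) (α : ℝ) : Prop :=
  ∃ f : ℕ → ℕ, (∀ s, natStr (f s) ∈ U P (natStr s)) ∧ ApproxFromBelow f α

/-- `α` is computable in `β`: the binary digits of `α` are Turing reducible to those of `β`. -/
def ComputableFrom (α β : ℝ) : Prop :=
  TuringReducible (fun i => Part.some (binDigit α i).toNat) (fun i => Part.some (binDigit β i).toNat)

/-! ### Search with an oracle -/

/-! Approximate the digits of `α` and `β` from below by `A` and `B`. A number `j = ⟨n, s⟩` names the
first change of `A` on `n` digits after stage `s`; call that change late if by then `B` has settled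
on `2 ^ (j + 1)` digits. The proof splits on whether late changes occur for infinitely many `j`.

If they do not, `β` computes `α` (`computableFrom_of_no_lateChange`): wait until `B` agrees with the
oracle on `2 ^ (j + 1)` digits. If `A` has not changed on its `n` digits since stage `s`, it never
will, as the change would be late.

If they do, a late `j` determines the stage of its change, so `j` and `r < 2 ^ j` determine `β_N`,
where `N = 2 ^ j + r`. A string of length `j` carries both numbers, hence `C(β_N) ≤ j + O(1)`. By
counting, `C(β_N) ≥ j - 2` for most `r`. As `j = log N` can be read off from `β_N`, the withheld
complexity is bounded for most `r` (`exists_card_withheldC_le`), and the hypothesis bounds `C(α_N ∣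
β_N)` there. So `α_j` is popular: a fixed finite list of programs yields it from `β_N` for more than
half of these `N`. Double counting leaves a bounded number of popular values
(`card_le_of_isPopular`).

To single out `α_j`, take the limsup `l`, over late `j`, of the number of popular values not above
`α_j`. With oracle `β`, find a late `j` and a stage where `l` popular values not above the current
`A` have appeared. These are then all of them, so `α_j` is among them, and `A` has reached `α_j`.
The thresholds and `l` are fixed non-uniformly, so the size of `d` plays no role. -/

theorem Nat.RecursiveIn.tot_comp {O : Set (ℕ →. ℕ)} {f g : ℕ → ℕ}
    (hf : Nat.RecursiveIn O fun n => Part.some (f n))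
    (hg : Nat.RecursiveIn O fun n => Part.some (g n)) :
    Nat.RecursiveIn O fun n => Part.some (f (g n)) :=
  (Nat.RecursiveIn.comp hf hg).of_eq fun n => by simp

theorem Nat.RecursiveIn.tot_pair {O : Set (ℕ →. ℕ)} {f g : ℕ → ℕ}
    (hf : Nat.RecursiveIn O fun n => Part.some (f n))
    (hg : Nat.RecursiveIn O fun n => Part.some (g n)) :
    Nat.RecursiveIn O fun n => Part.some (Nat.pair (f n) (g n)) :=
  (Nat.RecursiveIn.pair hf hg).of_eq fun n => by simp [Seq.seq]

theorem Computable.nat_recursiveIn {O : Set (ℕ →. ℕ)} {f : ℕ → ℕ} (hf : Computable f) :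
    Nat.RecursiveIn O fun n => Part.some (f n) :=
  RecursiveIn.iff_nat.1 hf.partrec.recursiveIn

/-- The number with binary digits `d 0, …, d (n - 1)` is recursive in the digit sequence `d`. -/
theorem recursiveIn_of_digits {d b : ℕ → ℕ} (b0 : b 0 = 0)
    (bs : ∀ n, b (n + 1) = 2 * b n + d n) :
    Nat.RecursiveIn {fun i => Part.some (d i)} fun n => Part.some (b n) := by
  have hc : ∀ {f : ℕ → ℕ}, Computable f →
      Nat.RecursiveIn {fun i => Part.some (d i)} fun n => Part.some (f n) :=
    fun hf => hf.nat_recursiveIn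
  have hun : Primrec Nat.unpair := Primrec.unpair
  have h1 : Computable fun m : ℕ => m.unpair.2.unpair.1 :=
    (Primrec.fst.comp (hun.comp (Primrec.snd.comp hun))).to_comp
  have h2 : Computable fun m : ℕ => m.unpair.2.unpair.2 :=
    (Primrec.snd.comp (hun.comp (Primrec.snd.comp hun))).to_comp
  have h3 : Computable fun m : ℕ => 2 * m.unpair.1 + m.unpair.2 :=
    (Primrec.nat_add.comp (Primrec.nat_mul.comp (Primrec.const 2) (Primrec.fst.comp hun))
      (Primrec.snd.comp hun)).to_comp
  have h4 : Computable fun n : ℕ => Nat.pair 0 n :=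
    (Primrec₂.natPair.comp (Primrec.const 0) Primrec.id).to_comp
  have ho : Nat.RecursiveIn {fun i => Part.some (d i)} fun i => Part.some (d i) :=
    .oracle _ rfl
  have step := (hc h3).tot_comp ((hc h2).tot_pair (ho.tot_comp (hc h1)))
  refine ((Nat.RecursiveIn.prec .zero step).comp (hc h4)).of_eq fun n => ?_
  simp only [Part.bind_eq_bind, Part.bind_some, Nat.unpair_pair]
  induction n with
  | zero => simp [b0]; rfl
  | succ n ih => simp only [ih, Part.bind_some, bs]

/-- Unbounded search for a number `k` with a decidable property of `k` and of an initial segment of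
the oracle. -/
theorem turingReducible_of_search {d b : ℕ → ℕ} (b0 : b 0 = 0)
    (bs : ∀ n, b (n + 1) = 2 * b n + d n) {u : ℕ → ℕ} (hu : Computable u)
    {R : ℕ → ℕ → ℕ → Bool} (hR : Computable fun t : ℕ × ℕ × ℕ => R t.1 t.2.1 t.2.2)
    {out : ℕ → ℕ → ℕ} (hout : Computable₂ out) {g : ℕ → ℕ}
    (hex : ∀ n, ∃ k, R n k (b (u k)) = true)
    (hspec : ∀ n k, R n k (b (u k)) = true → out n k = g n) :
    TuringReducible (fun i => Part.some (g i)) (fun i => Part.some (d i)) := by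
  refine RecursiveIn.iff_nat.2 ?_
  have hc : ∀ {f : ℕ → ℕ}, Computable f →
      Nat.RecursiveIn {fun i => Part.some (d i)} fun n => Part.some (f n) :=
    fun hf => hf.nat_recursiveIn
  have hb := recursiveIn_of_digits b0 bs
  -- The search operator of `Nat.RecursiveIn` looks for a zero, so 0 encodes success.
  let F : ℕ → ℕ := fun p => bif R p.unpair.1 p.unpair.2 (b (u p.unpair.2)) then 0 else 1
  have hun : Computable Nat.unpair := Computable.unpair
  have hF : Nat.RecursiveIn {fun i => Part.some (d i)} fun p => Part.some (F p) := by
    have h1 : Computable fun m : ℕ =>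
        bif R m.unpair.1.unpair.1 m.unpair.1.unpair.2 m.unpair.2 then 0 else 1 := by
      have hg : Computable fun m : ℕ =>
          (m.unpair.1.unpair.1, m.unpair.1.unpair.2, m.unpair.2) :=
        Computable.pair (Computable.fst.comp (hun.comp (Computable.fst.comp hun)))
          (Computable.pair (Computable.snd.comp (hun.comp (Computable.fst.comp hun)))
            (Computable.snd.comp hun))
      have h := Computable.comp hR hg
      exact Computable.cond h (Computable.const 0) (Computable.const 1)
    have h2 : Nat.RecursiveIn {fun i => Part.some (d i)}
        fun p => Part.some (Nat.pair p (b (u p.unpair.2))) :=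
      Nat.RecursiveIn.tot_pair (f := fun p => p) (hc Computable.id)
        (hb.tot_comp (hc (hu.comp (Computable.snd.comp hun))))
    refine (Nat.RecursiveIn.tot_comp (hc h1) h2).of_eq fun p => ?_
    simp only [Nat.unpair_pair, F]
  have h3 : Nat.RecursiveIn {fun i => Part.some (d i)}
      fun n => Nat.rfind fun k => ((R n k (b (u k)) : Bool) : Part Bool) := by
    refine (Nat.RecursiveIn.rfind hF).of_eq fun n => congrArg Nat.rfind (funext fun k => ?_)
    cases h : R n k (b (u k)) <;> simp [F, h]
  have h4 : Computable fun m : ℕ => out m.unpair.1 m.unpair.2 :=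
    hout.comp (Computable.fst.comp hun) (Computable.snd.comp hun)
  have h5 := Nat.RecursiveIn.comp (hc h4)
    (Nat.RecursiveIn.pair (f := fun n => Part.some n) (hc Computable.id) h3)
  refine Nat.RecursiveIn.of_eq_tot h5 fun n => ?_
  obtain ⟨k, hk⟩ := hex n
  obtain ⟨m, hm, -⟩ := Nat.rfind_min' (p := fun k => R n k (b (u k))) hk
  have hm' := Nat.rfind_spec hm
  have hm'' : R n m (b (u m)) = true := (Part.mem_some_iff.1 hm').symm
  have e : (Nat.rfind fun k => ((R n k (b (u k)) : Bool) : Part Bool)) = Part.some m :=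
    Part.eq_some_iff.2 hm
  rw [e]
  simp [Seq.seq, hspec n m hm'']

/-! ### Computability of bounded counting, powers and truth values -/

/-- The number of `i < n` with `p i`. -/
def boolCount (p : ℕ → Bool) (n : ℕ) : ℕ := n.rec 0 fun i c => c + (p i).toNat

theorem boolCount_eq_card (p : ℕ → Bool) (n : ℕ) :
    boolCount p n = ((Finset.range n).filter fun i => p i = true).card := by
  induction n with
  | zero => rfl
  | succ n ih =>
    change boolCount p n + (p n).toNat = _
    rw [ih, Finset.range_add_one, Finset.filter_insert]
    cases h : p n <;> simp

theorem Computable.boolCount {α : Type*} [Primcodable α] {p : α → ℕ → Bool} {n : α → ℕ}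
    (hp : Computable₂ p) (hn : Computable n) : Computable fun a => boolCount (p a) (n a) := by
  have h : Computable₂ fun (a : α) (c : ℕ × ℕ) => c.2 + (p a c.1).toNat :=
    Primrec.nat_add.to_comp.comp (Computable.snd.comp Computable.snd)
      ((Primrec.dom_bool Bool.toNat).to_comp.comp
        (hp.comp Computable.fst (Computable.fst.comp Computable.snd)))
  exact Computable.nat_rec hn (Computable.const 0) h

theorem Primrec.nat_pow : Primrec₂ ((· ^ ·) : ℕ → ℕ → ℕ) := Primrec₂.unpaired'.1 Nat.Primrec.pow

section
variable {α : Type*} [Primcodable α] {f g : α → ℕ} {p q : α → Bool}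

theorem Computable.add (hf : Computable f) (hg : Computable g) : Computable fun a => f a + g a :=
  Primrec.nat_add.to_comp.comp hf hg

theorem Computable.sub (hf : Computable f) (hg : Computable g) : Computable fun a => f a - g a :=
  Primrec.nat_sub.to_comp.comp hf hg

theorem Computable.mul (hf : Computable f) (hg : Computable g) : Computable fun a => f a * g a :=
  Primrec.nat_mul.to_comp.comp hf hg

theorem Computable.div (hf : Computable f) (hg : Computable g) : Computable fun a => f a / g a :=
  Primrec.nat_div.to_comp.comp hf hg

theorem Computable.mod (hf : Computable f) (hg : Computable g) : Computable fun a => f a % g a :=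
  Primrec.nat_mod.to_comp.comp hf hg

theorem Computable.two_pow (hf : Computable f) : Computable fun a => 2 ^ f a :=
  Primrec.nat_pow.to_comp.comp (Computable.const 2) hf

theorem Computable.decide_le (hf : Computable f) (hg : Computable g) :
    Computable fun a => decide (f a ≤ g a) :=
  Primrec.nat_le.decide.to_comp.comp hf hg

theorem Computable.decide_lt (hf : Computable f) (hg : Computable g) :
    Computable fun a => decide (f a < g a) :=
  Primrec.nat_lt.decide.to_comp.comp hf hg

theorem Computable.decide_eq {β : Type*} [Primcodable β] [DecidableEq β] {f g : α → β}
    (hf : Computable f) (hg : Computable g) : Computable fun a => decide (f a = g a) :=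
  Primrec.eq.decide.to_comp.comp hf hg

theorem Computable.and (hp : Computable p) (hq : Computable q) :
    Computable fun a => p a && q a :=
  Primrec.and.to_comp.comp hp hq

theorem Computable.not (hp : Computable p) : Computable fun a => !p a :=
  Primrec.not.to_comp.comp hp

theorem Computable.unpair_fst (hf : Computable f) : Computable fun a => (f a).unpair.1 :=
  Computable.fst.comp (Computable.unpair.comp hf)

theorem Computable.unpair_snd (hf : Computable f) : Computable fun a => (f a).unpair.2 :=
  Computable.snd.comp (Computable.unpair.comp hf)

end

/-- A partial computable function is the limit of a computable stagewise approximation. -/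
theorem Partrec.exists_stages {α σ : Type*} [Primcodable α] [Primcodable σ] {f : α →. σ}
    (hf : Partrec f) : ∃ H : ℕ → α → Option σ, Computable₂ H ∧
      (∀ s t a x, s ≤ t → x ∈ H s a → x ∈ H t a) ∧ ∀ a x, x ∈ f a ↔ ∃ s, x ∈ H s a := by
  obtain ⟨c, hc⟩ := Nat.Partrec.Code.exists_code.1 hf
  refine ⟨fun s a => (c.evaln s (Encodable.encode a)).bind (Encodable.decode (α := σ)), ?_, ?_, ?_⟩
  · refine Computable.option_bind ?_ (Computable.decode.comp Computable.snd)
    exact Nat.Partrec.Code.primrec_evaln.to_comp.comp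
      (Computable.pair (Computable.pair Computable.fst (Computable.const c))
        (Computable.encode.comp Computable.snd))
  · intro s t a x hst hx
    obtain ⟨v, hv, hx⟩ := Option.mem_bind_iff.1 hx
    exact Option.mem_bind_iff.2 ⟨v, Nat.Partrec.Code.evaln_mono hst hv, hx⟩
  · intro a x
    have hev : ∀ v, (∃ s, v ∈ c.evaln s (Encodable.encode a)) ↔
        v ∈ (f a).map Encodable.encode := fun v => by
      rw [← Nat.Partrec.Code.evaln_complete, hc]; simp
    constructor
    · intro hx
      obtain ⟨s, hs⟩ := (hev _).2 (Part.mem_map _ hx)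
      exact ⟨s, Option.mem_bind_iff.2 ⟨_, hs, by simp⟩⟩
    · rintro ⟨s, hs⟩
      obtain ⟨v, hv, hx⟩ := Option.mem_bind_iff.1 hs
      obtain ⟨y, hy, rfl⟩ := (Part.mem_map_iff _).1 ((hev v).1 ⟨s, hv⟩)
      simp at hx
      exact hx ▸ hy

/-! ### Binary strings and numbers -/

/-- The number with binary expansion `p` (most significant digit first). -/
def strVal (p : List Bool) : ℕ := p.foldl (fun a b => 2 * a + b.toNat) 0

/-- The number with binary expansion `1p`. -/
def strCode (p : List Bool) : ℕ := p.foldl (fun a b => 2 * a + b.toNat) 1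

/-- The `n` lowest binary digits of `v`, most significant digit first. -/
def bitStr (n v : ℕ) : List Bool :=
  (List.range n).map fun i => decide (v / 2 ^ (n - 1 - i) % 2 = 1)

@[simp] theorem length_bitStr (n v : ℕ) : (bitStr n v).length = n := by simp [bitStr]

theorem strVal_concat (p : List Bool) (b : Bool) :
    strVal (p ++ [b]) = 2 * strVal p + b.toNat := by simp [strVal]

theorem strCode_concat (p : List Bool) (b : Bool) :
    strCode (p ++ [b]) = 2 * strCode p + b.toNat := by simp [strCode]

theorem strCode_eq (p : List Bool) : strCode p = 2 ^ p.length + strVal p := by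
  induction p using List.reverseRecOn with
  | nil => rfl
  | append_singleton p b ih => rw [strCode_concat, strVal_concat, ih]; simp [pow_succ]; ring

theorem strVal_lt (p : List Bool) : strVal p < 2 ^ p.length := by
  induction p using List.reverseRecOn with
  | nil => simp [strVal]
  | append_singleton p b ih =>
    rw [strVal_concat, List.length_append, List.length_singleton, pow_succ]
    have := Bool.toNat_le b
    omega

/-- The leading 1 preserves leading zeros, so that programs of different lengths can be counted
together by their codes. -/
theorem strCode_injective : Function.Injective strCode := by
  intro p
  induction p using List.reverseRecOn with
  | nil =>
    intro q
    cases q using List.reverseRecOn with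
    | nil => simp
    | append_singleton q c =>
      intro h
      rw [strCode_concat, strCode_eq q] at h
      have h1 : strCode [] = 1 := rfl
      have := Nat.two_pow_pos q.length
      omega
  | append_singleton p b ih =>
    intro q
    cases q using List.reverseRecOn with
    | nil =>
      intro h
      rw [strCode_concat, strCode_eq p] at h
      have h1 : strCode [] = 1 := rfl
      have := Nat.two_pow_pos p.length
      omega
    | append_singleton q c =>
      intro h
      rw [strCode_concat, strCode_concat] at h
      have hb := Bool.toNat_le b
      have hc := Bool.toNat_le c
      have h1 : strCode p = strCode q := by omega
      have h2 : b.toNat = c.toNat := by omega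
      have h3 : b = c := by revert h2; cases b <;> cases c <;> simp
      rw [ih h1, h3]

theorem bitStr_succ (n v : ℕ) :
    bitStr (n + 1) v = bitStr n (v / 2) ++ [decide (v % 2 = 1)] := by
  unfold bitStr
  rw [List.range_succ, List.map_append]
  congr 1
  · refine List.map_congr_left fun i hi => ?_
    have hi := List.mem_range.1 hi
    rw [Nat.div_div_eq_div_mul, ← pow_succ']
    congr 5
    omega
  · simp

theorem strVal_bitStr (n v : ℕ) : strVal (bitStr n v) = v % 2 ^ n := by
  induction n generalizing v with
  | zero => simp [bitStr, strVal, Nat.mod_one]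
  | succ n ih =>
    rw [bitStr_succ, strVal_concat, ih, pow_succ', Nat.mod_mul]
    rcases Nat.mod_two_eq_zero_or_one v with h | h <;> simp [h, add_comm]

theorem strVal_bitStr_of_lt {n v : ℕ} (h : v < 2 ^ n) : strVal (bitStr n v) = v := by
  rw [strVal_bitStr, Nat.mod_eq_of_lt h]

theorem strCode_natStr (n : ℕ) : strCode (natStr n) = n + 1 := by
  have key : ∀ m : ℕ, m ≠ 0 → strCode (m.bits.dropLast.reverse) = m := by
    intro m
    induction m using Nat.binaryRec with
    | zero => simp
    | bit b m ih =>
      intro hm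
      rcases Nat.eq_zero_or_pos m with rfl | hpos
      · cases b
        · simp at hm
        · rfl
      · have hm0 : m ≠ 0 := hpos.ne'
        have hne : m.bits ≠ [] := by
          intro h
          have hl := Nat.size_eq_bits_len m
          rw [h] at hl
          simp at hl
          exact hm0 (Nat.size_eq_zero.1 hl.symm)
        rw [Nat.bits_append_bit m b (fun h => absurd h hm0), List.dropLast_cons_of_ne_nil hne,
          List.reverse_cons, strCode_concat, ih hm0, Nat.bit_val]
  exact key (n + 1) n.succ_ne_zero

/-- This closed form makes the identification of numbers with strings primitive recursive. -/
theorem natStr_eq_bitStr (n : ℕ) : natStr n = bitStr (Nat.log 2 (n + 1)) (n + 1) := by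
  apply strCode_injective
  rw [strCode_natStr, strCode_eq, strVal_bitStr, length_bitStr]
  have h1 : 2 ^ Nat.log 2 (n + 1) ≤ n + 1 := Nat.pow_log_le_self 2 n.succ_ne_zero
  have h2 := Nat.lt_pow_succ_log_self (b := 2) one_lt_two (n + 1)
  rw [pow_succ] at h2
  rw [Nat.mod_eq_sub_mod h1, Nat.mod_eq_of_lt (by omega)]
  omega

theorem Primrec.bitStr : Primrec₂ bitStr := by
  unfold _root_.bitStr
  refine Primrec.list_map (Primrec.list_range.comp Primrec.fst) ?_
  have h : Primrec fun a : (ℕ × ℕ) × ℕ => a.1.2 / 2 ^ (a.1.1 - 1 - a.2) % 2 :=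
    Primrec.nat_mod.comp (Primrec.nat_div.comp (Primrec.snd.comp Primrec.fst)
      (Primrec.nat_pow.comp (Primrec.const 2) (Primrec.nat_sub.comp
        (Primrec.nat_sub.comp (Primrec.fst.comp Primrec.fst) (Primrec.const 1)) Primrec.snd)))
      (Primrec.const 2)
  exact (Primrec.eq.decide.comp h (Primrec.const 1)).to₂

theorem Primrec.foldl_bits (c : ℕ) :
    Primrec fun p : List Bool => p.foldl (fun a b => 2 * a + b.toNat) c := by
  have h : Primrec₂ fun (_ : List Bool) (x : ℕ × Bool) => 2 * x.1 + x.2.toNat :=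
    Primrec.nat_add.comp (Primrec.nat_mul.comp (Primrec.const 2) (Primrec.fst.comp Primrec.snd))
      ((Primrec.dom_bool Bool.toNat).comp (Primrec.snd.comp Primrec.snd))
  exact Primrec.list_foldl Primrec.id (Primrec.const c) h

theorem Primrec.strVal : Primrec strVal := Primrec.foldl_bits 0

theorem Primrec.strCode : Primrec strCode := Primrec.foldl_bits 1

theorem Primrec.nat_log_two : Primrec (Nat.log 2) := by
  have h : Primrec fun v : ℕ => Nat.findGreatest (fun i => 2 ^ i ≤ v) v := by
    refine Primrec.nat_findGreatest Primrec.id ?_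
    exact Primrec.nat_le.comp (Primrec.nat_pow.comp (Primrec.const 2) Primrec.snd) Primrec.fst
  refine h.of_eq fun v => ?_
  rcases Nat.eq_zero_or_pos v with rfl | hv
  · simp
  · rw [Nat.findGreatest_eq_iff]
    refine ⟨Nat.log_le_self 2 v, fun _ => Nat.pow_log_le_self 2 hv.ne', fun n hn _ => ?_⟩
    rw [not_le]
    exact Nat.lt_pow_of_log_lt one_lt_two hn

theorem Primrec.natStr : Primrec natStr := by
  have h : Primrec fun n : ℕ => n + 1 := Primrec.succ
  exact (Primrec.bitStr.comp (Primrec.nat_log_two.comp h) h).of_eq fun n =>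
    (natStr_eq_bitStr n).symm

/-! ### The digits of a real number -/

/-- The number whose binary expansion consists of the first `n` digits of `α`. -/
noncomputable def digitsVal (α : ℝ) (n : ℕ) : ℕ := ⌊Int.fract α * 2 ^ n⌋₊

theorem digitsVal_zero (α : ℝ) : digitsVal α 0 = 0 := by
  simp [digitsVal, Int.fract_lt_one]

theorem digitsVal_lt (α : ℝ) (n : ℕ) : digitsVal α n < 2 ^ n := by
  rw [digitsVal, Nat.floor_lt (by have := Int.fract_nonneg α; positivity)]
  have := Int.fract_lt_one α
  push_cast
  exact mul_lt_of_lt_one_left (by positivity) this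

theorem binDigit_toNat (α : ℝ) (i : ℕ) : (binDigit α i).toNat = digitsVal α (i + 1) % 2 := by
  have h0 : 0 ≤ Int.fract α * 2 ^ (i + 1) := by have := Int.fract_nonneg α; positivity
  have h1 : ⌊α * 2 ^ (i + 1)⌋ = ⌊Int.fract α * 2 ^ (i + 1)⌋ + ⌊α⌋ * 2 ^ (i + 1) := by
    rw [← Int.floor_add_intCast]
    congr 1
    push_cast
    rw [← add_mul, Int.fract_add_floor]
  have h2 : (digitsVal α (i + 1) : ℤ) = ⌊Int.fract α * 2 ^ (i + 1)⌋ :=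
    Int.natCast_floor_eq_floor h0
  have h3 : ⌊α * 2 ^ (i + 1)⌋ % 2 = (digitsVal α (i + 1) : ℤ) % 2 := by
    rw [h1, h2, pow_succ (2 : ℤ) i, ← mul_assoc, Int.add_mul_emod_self_right]
  unfold binDigit
  rw [h3]
  rcases Nat.mod_two_eq_zero_or_one (digitsVal α (i + 1)) with h | h
  · have : (digitsVal α (i + 1) : ℤ) % 2 = 0 := by omega
    simp [this, h]
  · have : (digitsVal α (i + 1) : ℤ) % 2 = 1 := by omega
    simp [this, h]

theorem digitsVal_succ_div_two (α : ℝ) (n : ℕ) : digitsVal α (n + 1) / 2 = digitsVal α n := by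
  unfold digitsVal
  have := Nat.floor_div_natCast (Int.fract α * 2 ^ (n + 1)) 2
  rw [← this, pow_succ]
  congr 1
  push_cast
  field_simp

theorem digitsVal_succ (α : ℝ) (n : ℕ) :
    digitsVal α (n + 1) = 2 * digitsVal α n + (binDigit α n).toNat := by
  have := digitsVal_succ_div_two α n
  rw [binDigit_toNat]
  omega

theorem digitsVal_div (α : ℝ) {n m : ℕ} (h : n ≤ m) :
    digitsVal α m / 2 ^ (m - n) = digitsVal α n := by
  induction m, h using Nat.le_induction with
  | base => simp
  | succ m hm ih =>
    rw [Nat.succ_sub hm, pow_succ', ← Nat.div_div_eq_div_mul, digitsVal_succ_div_two, ih]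

theorem initSeg_eq_bitStr (α : ℝ) (n : ℕ) : initSeg α n = bitStr n (digitsVal α n) := by
  induction n with
  | zero => rfl
  | succ n ih =>
    have h : decide (digitsVal α (n + 1) % 2 = 1) = binDigit α n := by
      rw [← binDigit_toNat]; cases binDigit α n <;> simp
    rw [bitStr_succ, digitsVal_succ_div_two, ← ih, h]
    simp [initSeg, List.range_succ]

theorem length_initSeg (α : ℝ) (n : ℕ) : (initSeg α n).length = n := by simp [initSeg]

/-! ### Left c.e. reals -/

/-- `A s n` approximates the first `n` digits of `α` from below, and settles at the true value. -/
structure DigitApprox (A : ℕ → ℕ → ℕ) (α : ℝ) : Prop where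
  computable : Computable₂ A
  mono : ∀ n, Monotone fun s => A s n
  le : ∀ s n, A s n ≤ digitsVal α n
  settles : ∀ n, ∃ s, A s n = digitsVal α n

theorem DigitApprox.eq_of_le {A : ℕ → ℕ → ℕ} {α : ℝ} (h : DigitApprox A α) {s t n : ℕ}
    (hs : A s n = digitsVal α n) (hst : s ≤ t) : A t n = digitsVal α n :=
  le_antisymm (h.le t n) (hs ▸ h.mono n hst)

theorem DigitApprox.settles_after {A : ℕ → ℕ → ℕ} {α : ℝ} (h : DigitApprox A α) (n m : ℕ) :
    ∃ s, m ≤ s ∧ A s n = digitsVal α n := by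
  obtain ⟨s, hs⟩ := h.settles n
  exact ⟨max m s, le_max_left _ _, h.eq_of_le hs (le_max_right _ _)⟩

/-- Dyadic `α` needs separate treatment: rationals strictly below it may show the expansion ending
in ones forever. Here the digits are computable outright, so a constant approximation serves. -/
theorem exists_digitApprox_of_dyadic {α : ℝ} {k : ℕ} {m : ℤ} (h : α * 2 ^ k = m) :
    ∃ A, DigitApprox A α := by
  have h1 : Int.fract α * 2 ^ k = ((m - ⌊α⌋ * 2 ^ k : ℤ) : ℝ) := by
    rw [Int.fract, sub_mul, h]; push_cast; ring
  have h2 : 0 ≤ m - ⌊α⌋ * 2 ^ k := by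
    have h3 : (0 : ℝ) ≤ ((m - ⌊α⌋ * 2 ^ k : ℤ) : ℝ) := by
      rw [← h1]; have := Int.fract_nonneg α; positivity
    exact_mod_cast h3
  obtain ⟨w, hw⟩ := Int.eq_ofNat_of_zero_le h2
  have key : ∀ n, digitsVal α n = w * 2 ^ n / 2 ^ k := fun n => by
    rw [hw] at h1
    have h3 : Int.fract α = w / 2 ^ k := by
      rw [eq_div_iff (by positivity), h1]; simp
    have h4 : Int.fract α * 2 ^ n = ((w * 2 ^ n : ℕ) : ℝ) / ((2 ^ k : ℕ) : ℝ) := by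
      rw [h3]; push_cast; ring
    rw [digitsVal, h4, Nat.floor_div_eq_div]
  refine ⟨fun _ n => w * 2 ^ n / 2 ^ k, ?_, fun n => monotone_const, fun s n => (key n).ge,
    fun n => ⟨0, (key n).symm⟩⟩
  exact ((Computable.const w).mul (Computable.two_pow Computable.snd)).div
    (Computable.const (2 ^ k))

/-- A non-dyadic `α` lies strictly above each of its truncations, so the rationals eventually pass
the truncation and their digits settle. -/
theorem exists_digitApprox_of_not_dyadic {α : ℝ} (hα : IsLeftCE α)
    (h : ∀ (k : ℕ) (m : ℤ), α * 2 ^ k ≠ m) : ∃ A, DigitApprox A α := by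
  obtain ⟨f, hf, hmono, hlim⟩ := hα
  have hle : ∀ s, ((ratOfNat (f s) : ℚ) : ℝ) ≤ α := fun s =>
    Monotone.ge_of_tendsto (fun a b hab => by exact_mod_cast hmono hab) hlim s
  have hz : (⌊α⌋ : ℝ) < α := lt_of_le_of_ne (Int.floor_le α) fun e => h 0 ⌊α⌋ (by simp [e])
  -- From stage `s₀` on the terms exceed `⌊α⌋`, so the fractional parts `r s` are nonnegative and
  -- the truncated subtraction in `A` is exact.
  obtain ⟨s₀, hs₀⟩ := (hlim.eventually (lt_mem_nhds hz)).exists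
  let r : ℕ → ℝ := fun s => ((ratOfNat (f (s + s₀)) : ℚ) : ℝ) - ⌊α⌋
  have rmono : Monotone r := fun a b hab =>
    sub_le_sub_right (by exact_mod_cast hmono (Nat.add_le_add_right hab s₀)) _
  have rnonneg : ∀ s, 0 ≤ r s := fun s => by
    have : ratOfNat (f s₀) ≤ ratOfNat (f (s + s₀)) := hmono (Nat.le_add_left _ _)
    have : ((ratOfNat (f s₀) : ℚ) : ℝ) ≤ ratOfNat (f (s + s₀)) := by exact_mod_cast this
    simp only [r]; linarith
  have rle : ∀ s, r s ≤ Int.fract α := fun s => sub_le_sub_right (hle _) _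
  -- `⌊α⌋` is split into positive and negative parts to keep the numerator of `r s` a difference of
  -- natural numbers.
  let X : ℕ → ℕ := fun m => m.unpair.1.unpair.1 + (-⌊α⌋).toNat * (m.unpair.2 + 1)
  let Y : ℕ → ℕ := fun m => m.unpair.1.unpair.2 + ⌊α⌋.toNat * (m.unpair.2 + 1)
  let A : ℕ → ℕ → ℕ := fun s n =>
    (X (f (s + s₀)) - Y (f (s + s₀))) * 2 ^ n / ((f (s + s₀)).unpair.2 + 1)
  have hA : ∀ s n, A s n = ⌊r s * 2 ^ n⌋₊ := fun s n => by
    have hr : r s = ((X (f (s + s₀)) : ℝ) - Y (f (s + s₀))) / ((f (s + s₀)).unpair.2 + 1) := by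
      have hzz : (⌊α⌋ : ℝ) = (⌊α⌋.toNat : ℝ) - ((-⌊α⌋).toNat : ℝ) := by
        exact_mod_cast (Int.toNat_sub_toNat_neg ⌊α⌋).symm
      simp only [r, X, Y, ratOfNat]
      rw [hzz]
      push_cast
      field_simp
      ring
    have hXY : Y (f (s + s₀)) ≤ X (f (s + s₀)) := by
      have h1 := rnonneg s
      rw [hr, le_div_iff₀ (by positivity), zero_mul, sub_nonneg] at h1
      exact_mod_cast h1
    have h4 : r s * 2 ^ n = (((X (f (s + s₀)) - Y (f (s + s₀))) * 2 ^ n : ℕ) : ℝ) /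
        (((f (s + s₀)).unpair.2 + 1 : ℕ) : ℝ) := by
      rw [hr]; push_cast [Nat.cast_sub hXY]; ring
    rw [h4, Nat.floor_div_eq_div]
  refine ⟨A, ?_, ?_, ?_, ?_⟩
  · have hfs : Computable fun a : ℕ × ℕ => f (a.1 + s₀) :=
      hf.comp (Computable.fst.add (Computable.const s₀))
    have hden := hfs.unpair_snd.add (Computable.const 1)
    exact (((hfs.unpair_fst.unpair_fst.add ((Computable.const _).mul hden)).sub
      (hfs.unpair_fst.unpair_snd.add ((Computable.const _).mul hden))).mul
        (Computable.two_pow Computable.snd)).div hden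
  · intro n a b hab
    simp only [hA]
    exact Nat.floor_mono (mul_le_mul_of_nonneg_right (rmono hab) (by positivity))
  · intro s n
    rw [hA]
    exact Nat.floor_mono (mul_le_mul_of_nonneg_right (rle s) (by positivity))
  · intro n
    have hD : (digitsVal α n : ℝ) < Int.fract α * 2 ^ n := by
      refine lt_of_le_of_ne (Nat.floor_le (by have := Int.fract_nonneg α; positivity)) fun e => ?_
      refine h n (digitsVal α n + ⌊α⌋ * 2 ^ n) ?_
      push_cast
      rw [e, ← add_mul, Int.fract_add_floor]
    have hD' : (digitsVal α n : ℝ) / 2 ^ n + ⌊α⌋ < α := by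
      rw [← lt_sub_iff_add_lt, div_lt_iff₀ (by positivity)]
      exact hD
    obtain ⟨s, hs, hss⟩ := ((hlim.eventually (lt_mem_nhds hD')).and
      (Filter.eventually_ge_atTop s₀)).exists
    refine ⟨s - s₀, le_antisymm ?_ ?_⟩
    · rw [hA]
      exact Nat.floor_mono (mul_le_mul_of_nonneg_right (rle _) (by positivity))
    · rw [hA]
      refine Nat.le_floor ?_
      rw [← div_le_iff₀ (by positivity)]
      simp only [r, Nat.sub_add_cancel hss]
      linarith

theorem IsLeftCE.exists_digitApprox {α : ℝ} (hα : IsLeftCE α) : ∃ A, DigitApprox A α := by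
  by_cases h : ∃ (k : ℕ) (m : ℤ), α * 2 ^ k = m
  · obtain ⟨k, m, h⟩ := h
    exact exists_digitApprox_of_dyadic h
  · push Not at h
    exact exists_digitApprox_of_not_dyadic hα h

theorem IsProgramFor.isLeftCE {U : List Bool → List Bool →. List Bool} (hU : Partrec₂ U)
    {P : List Bool} {α : ℝ} (h : IsProgramFor U P α) : IsLeftCE α := by
  obtain ⟨f, hf, hα⟩ := h
  refine ⟨f, ?_, hα⟩
  have h1 : Partrec fun s : ℕ => U P (natStr s) :=
    hU.comp (Computable.const P) Primrec.natStr.to_comp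
  have h2 : Partrec fun s : ℕ => (U P (natStr s)).map fun z => strCode z - 1 :=
    h1.map (Computable.sub (Primrec.strCode.to_comp.comp Computable.snd) (Computable.const 1)).to₂
  refine h2.of_eq_tot fun s => ?_
  exact (Part.mem_map_iff _).2 ⟨_, hf s, by rw [strCode_natStr]; rfl⟩

/-! ### Changes of one approximation that come after another one has settled -/

/-- For `j = ⟨n, s⟩`: the first `n` digits in the approximation `A` change for the first time after
stage `s` at stage `T + 1`. -/
def changesAt (A : ℕ → ℕ → ℕ) (j T : ℕ) : Bool :=
  decide (j.unpair.2 ≤ T) && decide (A T j.unpair.1 = A j.unpair.2 j.unpair.1) &&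
    !decide (A (T + 1) j.unpair.1 = A j.unpair.2 j.unpair.1)

theorem changesAt_iff {A : ℕ → ℕ → ℕ} {j T : ℕ} : changesAt A j T = true ↔
    j.unpair.2 ≤ T ∧ A T j.unpair.1 = A j.unpair.2 j.unpair.1 ∧
      A (T + 1) j.unpair.1 ≠ A j.unpair.2 j.unpair.1 := by
  simp [changesAt, and_assoc]

theorem Computable.changesAt {A : ℕ → ℕ → ℕ} (hA : Computable₂ A) : Computable₂ (changesAt A) := by
  have hj : Computable fun a : ℕ × ℕ => a.1 := Computable.fst
  have hT : Computable fun a : ℕ × ℕ => a.2 := Computable.snd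
  have h0 := hA.comp hj.unpair_snd hj.unpair_fst
  exact ((Computable.decide_le hj.unpair_snd hT).and
    (Computable.decide_eq (hA.comp hT hj.unpair_fst) h0)).and
      (Computable.decide_eq (hA.comp (hT.add (Computable.const 1)) hj.unpair_fst) h0).not

/-- A monotone approximation never returns to a value it has left. Hence `j` alone determines the
stage of its change, and a machine given `j` can find it. -/
theorem changesAt_unique {A : ℕ → ℕ → ℕ} (hA : ∀ n, Monotone fun s => A s n) {j T T' : ℕ}
    (h : changesAt A j T = true) (h' : changesAt A j T' = true) : T = T' := by
  have aux : ∀ {T T'}, changesAt A j T = true → changesAt A j T' = true → ¬ T < T' := by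
    intro T T' h h' hlt
    obtain ⟨h1, h2, h3⟩ := changesAt_iff.1 h
    obtain ⟨-, h4, -⟩ := changesAt_iff.1 h'
    have h5 : A (T + 1) j.unpair.1 ≤ A T' j.unpair.1 := hA _ hlt
    have h6 : A T j.unpair.1 ≤ A (T + 1) j.unpair.1 := hA _ T.le_succ
    omega
  exact le_antisymm (not_lt.1 (aux h' h)) (not_lt.1 (aux h h'))

/-- The change of `A` described by `j` comes after `B` has settled on `2 ^ (j + 1)` digits. -/
def LateChange (A B : ℕ → ℕ → ℕ) (β : ℝ) (j T : ℕ) : Prop :=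
  changesAt A j T = true ∧ B (T + 1) (2 ^ (j + 1)) = digitsVal β (2 ^ (j + 1))

/-- If late changes do not occur from some point on, then stages at which the oracle has settled
are stages at which `α` has settled. -/
theorem computableFrom_of_no_lateChange {A B : ℕ → ℕ → ℕ} {α β : ℝ} (hA : DigitApprox A α)
    (hB : DigitApprox B β) {j₁ : ℕ} (h : ∀ j, j₁ ≤ j → ∀ T, ¬ LateChange A B β j T) :
    ComputableFrom α β := by
  refine turingReducible_of_search (b := digitsVal β) (u := fun k => 2 ^ (k.unpair.1 + 1))
    (R := fun i k v => decide (k.unpair.1.unpair.1 = i + 1) && decide (j₁ ≤ k.unpair.1) &&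
      decide (k.unpair.1.unpair.2 ≤ k.unpair.2) &&
      decide (B k.unpair.2 (2 ^ (k.unpair.1 + 1)) = v) &&
      decide (A k.unpair.2 (i + 1) = A k.unpair.1.unpair.2 (i + 1)))
    (out := fun i k => A k.unpair.1.unpair.2 (i + 1) % 2)
    (digitsVal_zero β) (digitsVal_succ β) ?_ ?_ ?_ ?_ ?_
  · exact Computable.two_pow (Computable.id.unpair_fst.add (Computable.const 1))
  · have hi : Computable fun t : ℕ × ℕ × ℕ => t.1 + 1 := Computable.fst.add (Computable.const 1)
    have hk : Computable fun t : ℕ × ℕ × ℕ => t.2.1 := Computable.fst.comp Computable.snd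
    have hv : Computable fun t : ℕ × ℕ × ℕ => t.2.2 := Computable.snd.comp Computable.snd
    exact ((((Computable.decide_eq hk.unpair_fst.unpair_fst hi).and
      (Computable.decide_le (Computable.const j₁) hk.unpair_fst)).and
      (Computable.decide_le hk.unpair_fst.unpair_snd hk.unpair_snd)).and
      (Computable.decide_eq (hB.computable.comp hk.unpair_snd
        (Computable.two_pow (hk.unpair_fst.add (Computable.const 1)))) hv)).and
      (Computable.decide_eq (hA.computable.comp hk.unpair_snd hi)
        (hA.computable.comp hk.unpair_fst.unpair_snd hi))
  · have hk : Computable fun t : ℕ × ℕ => t.2 := Computable.snd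
    exact (hA.computable.comp hk.unpair_fst.unpair_snd
      (Computable.fst.add (Computable.const 1))).mod (Computable.const 2)
  · intro i
    -- Taking `s₀ ≥ j₁` forces `j = ⟨i + 1, s₀⟩ ≥ j₁`.
    obtain ⟨s₀, hs₀, e₀⟩ := hA.settles_after (i + 1) j₁
    obtain ⟨s, hs, e⟩ := hB.settles_after (2 ^ (Nat.pair (i + 1) s₀ + 1)) s₀
    refine ⟨Nat.pair (Nat.pair (i + 1) s₀) s, ?_⟩
    have := hA.eq_of_le e₀ hs
    simp [e, hs, e₀, this, hs₀.trans (Nat.right_le_pair (i + 1) s₀)]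
  · intro i k hk
    simp only [Bool.and_eq_true, decide_eq_true_eq] at hk
    obtain ⟨⟨⟨⟨h1, h2⟩, h3⟩, h4⟩, h5⟩ := hk
    rw [binDigit_toNat]
    congr 1
    by_contra hne
    have hex : ∃ d, A (k.unpair.2 + d) (i + 1) ≠ A k.unpair.1.unpair.2 (i + 1) := by
      obtain ⟨s, hs, e⟩ := hA.settles_after (i + 1) k.unpair.2
      refine ⟨s - k.unpair.2, ?_⟩
      rw [Nat.add_sub_cancel' hs, e]
      exact fun e' => hne e'.symm
    classical
    have hf := Nat.find_spec hex
    have hmin := fun m => Nat.find_min hex (m := m)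
    rcases hd : Nat.find hex with _ | d
    · rw [hd] at hf
      exact hf h5
    · rw [hd] at hf hmin
      have hd' := hmin d d.lt_succ_self
      rw [not_not] at hd'
      refine h k.unpair.1 h2 (k.unpair.2 + d) ⟨changesAt_iff.2 ⟨by omega, ?_, ?_⟩, ?_⟩
      · rw [h1]; exact hd'
      · rw [h1]; exact hf
      · exact hB.eq_of_le h4 (by omega)

/-! ### Complexity bounds -/

section
variable {U : List Bool → List Bool →. List Bool}

/-- Comparison with the machine that prints its program shows that every string has a description,
so the infimum is attained rather than the default 0. -/
theorem IsUniversalOptimal.exists_shortest (hU : IsUniversalOptimal U) (x y : List Bool) :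
    ∃ p, x ∈ U p y ∧ p.length = condC U x y := by
  obtain ⟨c, hc⟩ := hU.optimal (fun p _ => Part.some p) (Computable.fst.partrec)
  obtain ⟨q, hq, -⟩ := hc x y x (Part.mem_some x)
  exact Nat.sInf_mem (s := {l | ∃ p : List Bool, x ∈ U p y ∧ p.length = l}) ⟨_, q, hq, rfl⟩

theorem condC_le {x y p : List Bool} (h : x ∈ U p y) : condC U x y ≤ p.length :=
  Nat.sInf_le ⟨p, h, rfl⟩

/-- A late change makes the initial segments of `β` easy to describe from their lengths. -/
theorem IsUniversalOptimal.exists_plainC_initSeg_le (hU : IsUniversalOptimal U)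
    {A B : ℕ → ℕ → ℕ} {β : ℝ} (hA : Computable₂ A) (hmono : ∀ n, Monotone fun s => A s n)
    (hB : Computable₂ B) : ∃ c, ∀ j T, LateChange A B β j T → ∀ r < 2 ^ j,
      plainC U (initSeg β (2 ^ j + r)) ≤ j + c := by
  -- The length of `p` supplies `j` and its value supplies `r`, so `j` bits encode both.
  let V : List Bool → List Bool →. List Bool := fun p _ =>
    (Nat.rfind fun T => ((changesAt A p.length T : Bool) : Part Bool)).map fun T =>
      bitStr (2 ^ p.length + strVal p)
        (B (T + 1) (2 ^ (p.length + 1)) / 2 ^ (2 ^ (p.length + 1) - (2 ^ p.length + strVal p)))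
  have hV : Partrec₂ V := by
    have h1 : Partrec fun a : List Bool × List Bool =>
        Nat.rfind fun T => ((changesAt A a.1.length T : Bool) : Part Bool) := by
      refine Partrec.rfind ?_
      exact ((Computable.changesAt hA).comp
        (Computable.list_length.comp (Computable.fst.comp Computable.fst)) Computable.snd).partrec
    refine Partrec.map h1 ?_
    have hp : Computable fun a : (List Bool × List Bool) × ℕ => a.1.1 :=
      Computable.fst.comp Computable.fst
    have hl : Computable fun a : (List Bool × List Bool) × ℕ => a.1.1.length :=
      Computable.list_length.comp hp
    have hN := (Computable.two_pow hl).add (Primrec.strVal.to_comp.comp hp)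
    have hJ := Computable.two_pow (hl.add (Computable.const 1))
    have hT : Computable fun a : (List Bool × List Bool) × ℕ => a.2 + 1 :=
      Computable.snd.add (Computable.const 1)
    exact Primrec.bitStr.to_comp.comp hN ((hB.comp hT hJ).div (Computable.two_pow (hJ.sub hN)))
  obtain ⟨c, hc⟩ := hU.optimal V hV
  refine ⟨c, fun j T hT r hr => ?_⟩
  have hx : initSeg β (2 ^ j + r) ∈ V (bitStr j r) [] := by
    refine (Part.mem_map_iff _).2 ⟨T, ?_, ?_⟩
    · obtain ⟨T', hT', -⟩ := Nat.rfind_min' (p := changesAt A j) hT.1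
      have h1 : changesAt A j T' = true := (Part.mem_some_iff.1 (Nat.rfind_spec hT')).symm
      rw [changesAt_unique hmono hT.1 h1]
      simp only [length_bitStr]
      exact hT'
    · rw [length_bitStr, strVal_bitStr_of_lt hr, hT.2,
        digitsVal_div β (by rw [pow_succ]; omega), initSeg_eq_bitStr]
  obtain ⟨q, hq, hl⟩ := hc _ _ _ hx
  exact (condC_le hq).trans (by simpa using hl)

/-- A number close to the logarithm of the length of `y` is easy to describe from `y`. -/
theorem IsUniversalOptimal.exists_condC_natStr_le (hU : IsUniversalOptimal U) :
    ∃ c, ∀ (y : List Bool) (m e : ℕ), m + 2 = Nat.log 2 y.length + e →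
      condC U (natStr m) y ≤ e + c := by
  -- The program encodes the correction `e` in unary by its length; the shift by 2 makes room for
  -- values down to two below the logarithm.
  have hV : Partrec₂ fun p y : List Bool =>
      Part.some (natStr (Nat.log 2 y.length + p.length - 2)) := by
    refine Computable.partrec (f := fun a : List Bool × List Bool =>
      natStr (Nat.log 2 a.2.length + a.1.length - 2)) ?_
    exact Primrec.natStr.to_comp.comp (((Primrec.nat_log_two.to_comp.comp
      (Computable.list_length.comp Computable.snd)).add
      (Computable.list_length.comp Computable.fst)).sub (Computable.const 2))
  obtain ⟨c, hc⟩ := hU.optimal _ hV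
  refine ⟨c, fun y m e h => ?_⟩
  obtain ⟨q, hq, hl⟩ := hc (List.replicate e true) y (natStr m)
    (by rw [List.length_replicate, ← h]; simp)
  exact (condC_le hq).trans (by simpa using hl)

/-- Few strings of distinct lengths have small complexity. -/
theorem IsUniversalOptimal.four_mul_card_plainC_le (hU : IsUniversalOptimal U) (β : ℝ) (j : ℕ) :
    4 * ((Finset.range (2 ^ j)).filter fun r =>
      plainC U (initSeg β (2 ^ j + r)) + 2 < j).card ≤ 2 ^ j := by
  rcases lt_or_ge j 3 with hj | hj
  · have : ((Finset.range (2 ^ j)).filter fun r =>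
        plainC U (initSeg β (2 ^ j + r)) + 2 < j) = ∅ := by
      apply Finset.filter_false_of_mem
      intro r _
      omega
    simp [this]
  choose p hp hl using fun N => hU.exists_shortest (initSeg β N) []
  have hj2 : 2 ^ j = 4 * 2 ^ (j - 2) := by
    rw [show (4 : ℕ) = 2 ^ 2 by norm_num, ← pow_add]; congr 1; omega
  -- Shortest programs of length below `j - 2` have codes below `2 ^ (j - 2)`, a quarter of `2 ^ j`.
  -- They are distinct because their outputs have different lengths.
  have hcard := Finset.card_le_card_of_injOn (s := (Finset.range (2 ^ j)).filter fun r =>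
      plainC U (initSeg β (2 ^ j + r)) + 2 < j) (t := Finset.range (2 ^ (j - 2)))
      (fun r => strCode (p (2 ^ j + r))) ?_ ?_
  · rw [Finset.card_range] at hcard
    omega
  · intro r hr
    have hr := (Finset.mem_filter.1 hr).2
    have h1 := strVal_lt (p (2 ^ j + r))
    have h2 : 2 ^ (p (2 ^ j + r)).length * 2 ≤ 2 ^ (j - 2) := by
      rw [← pow_succ]
      refine Nat.pow_le_pow_right two_pos ?_
      rw [hl]
      unfold plainC at hr
      omega
    simp only [Finset.coe_range, Set.mem_Iio, strCode_eq]
    omega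
  · intro r _ r' _ h
    have h1 := strCode_injective h
    have h2 := hp (2 ^ j + r)
    rw [h1] at h2
    have h3 := congrArg List.length (Part.mem_unique h2 (hp (2 ^ j + r')))
    rw [length_initSeg, length_initSeg] at h3
    omega

/-- At a late change most initial segments of `β` withhold only a bounded amount. -/
theorem IsUniversalOptimal.exists_card_withheldC_le (hU : IsUniversalOptimal U)
    {A B : ℕ → ℕ → ℕ} {β : ℝ} (hA : Computable₂ A) (hmono : ∀ n, Monotone fun s => A s n)
    (hB : Computable₂ B) : ∃ c, ∀ j T, LateChange A B β j T →
      2 ^ j < 2 * ((Finset.range (2 ^ j)).filter fun r =>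
        withheldC U β (2 ^ j + r) ≤ c).card := by
  obtain ⟨c₁, h₁⟩ := hU.exists_plainC_initSeg_le (β := β) hA hmono hB
  obtain ⟨c₂, h₂⟩ := hU.exists_condC_natStr_le
  refine ⟨c₁ + 2 + c₂, fun j T hT => ?_⟩
  have hsub : ((Finset.range (2 ^ j)).filter fun r =>
      ¬ plainC U (initSeg β (2 ^ j + r)) + 2 < j) ⊆
      (Finset.range (2 ^ j)).filter fun r => withheldC U β (2 ^ j + r) ≤ c₁ + 2 + c₂ := by
    intro r hr
    obtain ⟨hr, hlow⟩ := Finset.mem_filter.1 hr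
    refine Finset.mem_filter.2 ⟨hr, ?_⟩
    have hr := Finset.mem_range.1 hr
    have hup := h₁ j T hT r hr
    have hlog : Nat.log 2 (2 ^ j + r) = j :=
      Nat.log_eq_of_pow_le_of_lt_pow (by omega) (by rw [pow_succ]; omega)
    -- The correction is at most `c₁ + 2`, since the complexity lies between `j - 2` and `j + c₁`.
    have := h₂ (initSeg β (2 ^ j + r)) (plainC U (initSeg β (2 ^ j + r)))
      (plainC U (initSeg β (2 ^ j + r)) + 2 - j) (by rw [length_initSeg, hlog]; omega)
    unfold withheldC
    omega
  have h1 := Finset.card_le_card hsub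
  have h2 := Finset.card_filter_add_card_filter_not (s := Finset.range (2 ^ j))
    (fun r => plainC U (initSeg β (2 ^ j + r)) + 2 < j)
  have h3 := hU.four_mul_card_plainC_le β j
  rw [Finset.card_range] at h2
  have := Nat.two_pow_pos j
  omega

end

/-! ### Popular candidates -/

/-- The programs are listed as `progOfNat 0, progOfNat 1, …`. -/
def progOfNat (m : ℕ) : List Bool := (Encodable.decode (α := List Bool) m).getD []

theorem progOfNat_encode (p : List Bool) : progOfNat (Encodable.encode p) = p := by
  simp [progOfNat]

theorem exists_forall_length_le_progOfNat (e : ℕ) :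
    ∃ M, ∀ p : List Bool, p.length ≤ e → ∃ m < M, progOfNat m = p := by
  obtain ⟨M, hM⟩ := ((List.finite_length_le Bool e).image Encodable.encode).bddAbove
  exact ⟨M + 1, fun p hp => ⟨Encodable.encode p,
    Nat.lt_succ_of_le (hM ⟨p, hp, rfl⟩), progOfNat_encode p⟩⟩

section
variable (U : List Bool → List Bool →. List Bool) (M : ℕ)

/-- One of the first `M` programs computes from `y` the expansion of a number (to `N` digits) whose
first `j` digits form `x`. -/
def IsCandidate (j N : ℕ) (y : List Bool) (x : ℕ) : Prop :=
  ∃ m < M, ∃ z ∈ U (progOfNat m) y, strVal z / 2 ^ (N - j) = x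

open Classical in
/-- `x` is a candidate for more than half of the lengths in `[2 ^ j, 2 ^ (j + 1))`. -/
def IsPopular (β : ℝ) (j x : ℕ) : Prop :=
  2 ^ j < 2 * ((Finset.range (2 ^ j)).filter fun r =>
    IsCandidate U M j (2 ^ j + r) (initSeg β (2 ^ j + r)) x).card

variable {U M}

/-- On a given `y` each program has at most one output, so distinct candidates need distinct
programs. -/
theorem card_le_of_isCandidate {j N : ℕ} {y : List Bool} {X : Finset ℕ}
    (h : ∀ x ∈ X, IsCandidate U M j N y x) : X.card ≤ M := by
  choose! m hm z hz hx using h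
  have := Finset.card_le_card_of_injOn (s := X) (t := Finset.range M) m
    (fun x hx' => by simpa using hm x hx') (fun x h1 x' h2 e => by
      have h3 := hz x h1
      rw [show m x = m x' from e] at h3
      rw [← hx x h1, ← hx x' h2, Part.mem_unique h3 (hz x' h2)])
  simpa using this

/-- Count pairs of a value and a length: each value in `X` uses more than half of the `2 ^ j`
lengths, while each length admits at most `M` candidates. -/
theorem card_le_of_isPopular {β : ℝ} {j : ℕ} {X : Finset ℕ}
    (h : ∀ x ∈ X, IsPopular U M β j x) : X.card ≤ 2 * M := by
  classical
  have h1 : X.card * 2 ^ j ≤ ∑ x ∈ X, 2 * ((Finset.range (2 ^ j)).filter fun r =>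
      IsCandidate U M j (2 ^ j + r) (initSeg β (2 ^ j + r)) x).card := by
    rw [← smul_eq_mul]
    refine Finset.card_nsmul_le_sum _ _ _ fun x hx => ?_
    have := h x hx
    unfold IsPopular at this
    convert this.le
  have h2 : ∑ x ∈ X, ((Finset.range (2 ^ j)).filter fun r =>
      IsCandidate U M j (2 ^ j + r) (initSeg β (2 ^ j + r)) x).card ≤ 2 ^ j * M := by
    have h3 := Finset.sum_card_bipartiteAbove_eq_sum_card_bipartiteBelow (s := X)
      (t := Finset.range (2 ^ j))
      (fun x r => IsCandidate U M j (2 ^ j + r) (initSeg β (2 ^ j + r)) x)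
    unfold Finset.bipartiteAbove Finset.bipartiteBelow at h3
    rw [h3]
    have h4 := Finset.sum_le_card_nsmul (Finset.range (2 ^ j)) (fun r => (X.filter fun x =>
      IsCandidate U M j (2 ^ j + r) (initSeg β (2 ^ j + r)) x).card) M
      (fun r _ => card_le_of_isCandidate fun x hx => (Finset.mem_filter.1 hx).2)
    simpa using h4
  rw [← Finset.mul_sum] at h1
  refine Nat.le_of_mul_le_mul_right (h1.trans ?_) (Nat.two_pow_pos j)
  nlinarith

/-- At a late change, the true digits of `α` are popular. -/
theorem IsUniversalOptimal.exists_isPopular (hU : IsUniversalOptimal U)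
    {A B : ℕ → ℕ → ℕ} {α β : ℝ} (hA : DigitApprox A α) (hB : DigitApprox B β) {d : ℕ}
    (hd : ∀ n, condC U (initSeg α n) (initSeg β n) ≤ withheldC U β n + d) :
    ∃ M, ∀ j T, LateChange A B β j T → IsPopular U M β j (digitsVal α j) := by
  classical
  obtain ⟨c, hc⟩ := hU.exists_card_withheldC_le (β := β) hA.computable hA.mono hB.computable
  obtain ⟨M, hM⟩ := exists_forall_length_le_progOfNat (c + d)
  refine ⟨M, fun j T hT => (hc j T hT).trans_le ?_⟩
  refine Nat.mul_le_mul_left 2 (Finset.card_le_card fun r hr => ?_)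
  obtain ⟨hr, hw⟩ := Finset.mem_filter.1 hr
  refine Finset.mem_filter.2 ⟨hr, ?_⟩
  obtain ⟨p, hp, hl⟩ := hU.exists_shortest (initSeg α (2 ^ j + r)) (initSeg β (2 ^ j + r))
  have := hd (2 ^ j + r)
  obtain ⟨m, hm, rfl⟩ := hM p (by omega)
  refine ⟨m, hm, _, hp, ?_⟩
  rw [initSeg_eq_bitStr, strVal_bitStr_of_lt (digitsVal_lt _ _),
    digitsVal_div α (by have := Nat.lt_two_pow_self (n := j); omega)]

end

/-! ### Stagewise search for popular candidates -/

section
variable (H : ℕ → List Bool × List Bool → Option (List Bool)) (M : ℕ)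

/-- The number of the first `M` programs that make `x` a candidate at stage `s`. -/
def candidateCount (s j N : ℕ) (y : List Bool) (x : ℕ) : ℕ :=
  boolCount (fun m => decide
    ((H s (progOfNat m, y)).map (fun z => strVal z / 2 ^ (N - j)) = some x)) M

/-- `x` looks popular at stage `s`, where `v` encodes the first `2 ^ (j + 1)` digits of `β`. -/
def popularAt (s j v x : ℕ) : Bool :=
  decide (2 ^ j < 2 * boolCount (fun r => decide (0 < candidateCount H M s j (2 ^ j + r)
    (bitStr (2 ^ j + r) (v / 2 ^ (2 ^ (j + 1) - (2 ^ j + r)))) x)) (2 ^ j))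

variable {H M}

theorem candidateCount_pos_iff {s j N : ℕ} {y : List Bool} {x : ℕ} :
    0 < candidateCount H M s j N y x ↔
      ∃ m < M, ∃ z ∈ H s (progOfNat m, y), strVal z / 2 ^ (N - j) = x := by
  simp [candidateCount, boolCount_eq_card, Finset.card_pos, Finset.Nonempty]

theorem popularAt_iff {β : ℝ} {s j x : ℕ} :
    popularAt H M s j (digitsVal β (2 ^ (j + 1))) x = true ↔
      2 ^ j < 2 * ((Finset.range (2 ^ j)).filter fun r =>
        0 < candidateCount H M s j (2 ^ j + r) (initSeg β (2 ^ j + r)) x).card := by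
  rw [popularAt, decide_eq_true_eq, boolCount_eq_card]
  have : ((Finset.range (2 ^ j)).filter fun r => decide (0 < candidateCount H M s j (2 ^ j + r)
      (bitStr (2 ^ j + r) (digitsVal β (2 ^ (j + 1)) / 2 ^ (2 ^ (j + 1) - (2 ^ j + r)))) x) = true)
      = (Finset.range (2 ^ j)).filter fun r =>
        0 < candidateCount H M s j (2 ^ j + r) (initSeg β (2 ^ j + r)) x := by
    refine Finset.filter_congr fun r hr => ?_
    have hr := Finset.mem_range.1 hr
    rw [digitsVal_div β (by rw [pow_succ]; omega), ← initSeg_eq_bitStr, decide_eq_true_eq]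
  rw [this]

variable {U : List Bool → List Bool →. List Bool}

theorem isPopular_of_popularAt (hH : ∀ a x, x ∈ U a.1 a.2 ↔ ∃ s, x ∈ H s a) {β : ℝ} {s j x : ℕ}
    (h : popularAt H M s j (digitsVal β (2 ^ (j + 1))) x = true) : IsPopular U M β j x := by
  classical
  refine (popularAt_iff.1 h).trans_le (Nat.mul_le_mul_left 2 (Finset.card_le_card fun r hr => ?_))
  obtain ⟨hr, hw⟩ := Finset.mem_filter.1 hr
  obtain ⟨m, hm, z, hz, hx⟩ := candidateCount_pos_iff.1 hw
  exact Finset.mem_filter.2 ⟨hr, m, hm, z, (hH (progOfNat m, _) z).2 ⟨s, hz⟩, hx⟩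

/-- Popularity rests on finitely many halting computations, and `H` retains each one once it
appears. -/
theorem eventually_popularAt (hmono : ∀ s t a x, s ≤ t → x ∈ H s a → x ∈ H t a)
    (hH : ∀ a x, x ∈ U a.1 a.2 ↔ ∃ s, x ∈ H s a) {β : ℝ} {j x : ℕ} (h : IsPopular U M β j x) :
    ∀ᶠ s in Filter.atTop, popularAt H M s j (digitsVal β (2 ^ (j + 1))) x = true := by
  classical
  have hev : ∀ r ∈ (Finset.range (2 ^ j)).filter (fun r =>
      IsCandidate U M j (2 ^ j + r) (initSeg β (2 ^ j + r)) x), ∀ᶠ s in Filter.atTop,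
      0 < candidateCount H M s j (2 ^ j + r) (initSeg β (2 ^ j + r)) x := by
    intro r hr
    obtain ⟨m, hm, z, hz, hx⟩ := (Finset.mem_filter.1 hr).2
    obtain ⟨s, hs⟩ := (hH (progOfNat m, _) z).1 hz
    filter_upwards [Filter.eventually_ge_atTop s] with t ht
    exact candidateCount_pos_iff.2 ⟨m, hm, z, hmono s t _ _ ht hs, hx⟩
  filter_upwards [(Finset.eventually_all _).2 hev] with s hs
  refine popularAt_iff.2 (lt_of_lt_of_le h (Nat.mul_le_mul_left 2 (Finset.card_le_card ?_)))
  intro r hr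
  exact Finset.mem_filter.2 ⟨(Finset.mem_filter.1 hr).1, hs r hr⟩

theorem Computable.candidateCount {γ : Type*} [Primcodable γ] (hH : Computable₂ H)
    {s j N x : γ → ℕ} {y : γ → List Bool} (hs : Computable s) (hj : Computable j)
    (hN : Computable N) (hy : Computable y) (hx : Computable x) :
    Computable fun a => candidateCount H M (s a) (j a) (N a) (y a) (x a) := by
  refine Computable.boolCount ?_ (Computable.const M)
  have hprog : Computable progOfNat := Computable.option_getD Computable.decode (Computable.const [])
  have h1 : Computable fun a : γ × ℕ => H (s a.1) (progOfNat a.2, y a.1) :=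
    hH.comp (hs.comp Computable.fst)
      ((hprog.comp Computable.snd).pair (hy.comp Computable.fst))
  have h2 : Computable₂ fun (a : γ × ℕ) (z : List Bool) => strVal z / 2 ^ (N a.1 - j a.1) :=
    (Primrec.strVal.to_comp.comp Computable.snd).div (Computable.two_pow
      ((hN.comp (Computable.fst.comp Computable.fst)).sub
        (hj.comp (Computable.fst.comp Computable.fst))))
  exact Computable.decide_eq (Computable.option_map h1 h2)
    (Computable.option_some.comp (hx.comp Computable.fst))

theorem Computable.popularAt {γ : Type*} [Primcodable γ] (hH : Computable₂ H)
    {s j v x : γ → ℕ} (hs : Computable s) (hj : Computable j) (hv : Computable v)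
    (hx : Computable x) : Computable fun a => popularAt H M (s a) (j a) (v a) (x a) := by
  refine Computable.decide_lt (Computable.two_pow hj) ((Computable.const 2).mul ?_)
  refine Computable.boolCount ?_ (Computable.two_pow hj)
  have hj' : Computable fun a : γ × ℕ => j a.1 := hj.comp Computable.fst
  have hN : Computable fun a : γ × ℕ => 2 ^ j a.1 + a.2 :=
    (Computable.two_pow hj').add Computable.snd
  have hy : Computable fun a : γ × ℕ => bitStr (2 ^ j a.1 + a.2)
      (v a.1 / 2 ^ (2 ^ (j a.1 + 1) - (2 ^ j a.1 + a.2))) :=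
    Primrec.bitStr.to_comp.comp hN ((hv.comp Computable.fst).div (Computable.two_pow
      ((Computable.two_pow (hj'.add (Computable.const 1))).sub hN)))
  exact Computable.decide_lt (Computable.const 0) (Computable.candidateCount hH
    (hs.comp Computable.fst) hj' hN hy (hx.comp Computable.fst))

end

/-! ### The theorem -/

/-- A bounded function has a largest value attained arbitrarily far out. -/
theorem exists_limsup_of_bounded {S : ℕ → Prop} {f : ℕ → ℕ} {b : ℕ} (hb : ∀ j, f j ≤ b)
    (hS : ∀ m, ∃ j, m ≤ j ∧ S j) :
    ∃ l i, (∀ j, i ≤ j → S j → f j ≤ l) ∧ ∀ m, ∃ j, m ≤ j ∧ S j ∧ l ≤ f j := by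
  classical
  let P : ℕ → Prop := fun l => ∀ m, ∃ j, m ≤ j ∧ S j ∧ l ≤ f j
  have h0 : P 0 := fun m => (hS m).imp fun j h => ⟨h.1, h.2, Nat.zero_le _⟩
  have hP : P (Nat.findGreatest P b) := Nat.findGreatest_spec (Nat.zero_le b) h0
  have hn : ¬ P (Nat.findGreatest P b + 1) := fun h => by
    rcases le_or_gt (Nat.findGreatest P b + 1) b with h1 | h1
    · exact Nat.findGreatest_is_greatest (Nat.lt_succ_self _) h1 h
    · obtain ⟨j, -, -, hj⟩ := h 0
      have := hb j
      omega
  simp only [P, not_forall, not_exists, not_and] at hn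
  obtain ⟨i, hi⟩ := hn
  exact ⟨_, i, fun j hj hSj => Nat.le_of_lt_succ (not_le.1 (hi j hj hSj)), hP⟩

theorem computableFrom_of_lateChanges {U : List Bool → List Bool →. List Bool}
    (hU : IsUniversalOptimal U) {A B : ℕ → ℕ → ℕ} {α β : ℝ} (hA : DigitApprox A α)
    (hB : DigitApprox B β) {d : ℕ}
    (hd : ∀ n, condC U (initSeg α n) (initSeg β n) ≤ withheldC U β n + d)
    (hlate : ∀ m, ∃ j, m ≤ j ∧ ∃ T, LateChange A B β j T) : ComputableFrom α β := by
  classical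
  obtain ⟨M, hM⟩ := hU.exists_isPopular hA hB hd
  obtain ⟨H, hHc, hHm, hH⟩ := hU.partrec.exists_stages
  -- Only popular values up to `α_j` count: the search tests values up to `A s j`, which never
  -- exceeds `α_j`.
  let Q : ℕ → Finset ℕ := fun j =>
    (Finset.range (digitsVal α j + 1)).filter fun x => IsPopular U M β j x
  obtain ⟨l, i₀, hle, hge⟩ := exists_limsup_of_bounded (S := fun j => ∃ T, LateChange A B β j T)
    (f := fun j => (Q j).card) (b := 2 * M)
    (fun j => card_le_of_isPopular (U := U) (β := β) (j := j)
      fun x hx => (Finset.mem_filter.1 hx).2) hlate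
  -- Here `k = ⟨j, ⟨T, s⟩⟩`: the oracle confirms that the change at `T + 1` is late, and `s` is the
  -- stage at which popular values are counted.
  refine turingReducible_of_search (b := digitsVal β) (u := fun k => 2 ^ (k.unpair.1 + 1))
    (R := fun i k v => decide (i < k.unpair.1) && decide (i₀ ≤ k.unpair.1) &&
      changesAt A k.unpair.1 k.unpair.2.unpair.1 &&
      decide (B (k.unpair.2.unpair.1 + 1) (2 ^ (k.unpair.1 + 1)) = v) &&
      decide (l ≤ boolCount (popularAt H M k.unpair.2.unpair.2 k.unpair.1 v)
        (A k.unpair.2.unpair.2 k.unpair.1 + 1)))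
    (out := fun i k => A k.unpair.2.unpair.2 k.unpair.1 / 2 ^ (k.unpair.1 - (i + 1)) % 2)
    (digitsVal_zero β) (digitsVal_succ β) ?_ ?_ ?_ ?_ ?_
  · exact Computable.two_pow (Computable.id.unpair_fst.add (Computable.const 1))
  · have hi : Computable fun t : ℕ × ℕ × ℕ => t.1 := Computable.fst
    have hk : Computable fun t : ℕ × ℕ × ℕ => t.2.1 := Computable.fst.comp Computable.snd
    have hv : Computable fun t : ℕ × ℕ × ℕ => t.2.2 := Computable.snd.comp Computable.snd
    have hj := hk.unpair_fst
    have hT := hk.unpair_snd.unpair_fst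
    have hs := hk.unpair_snd.unpair_snd
    have hp : Computable₂ fun (t : ℕ × ℕ × ℕ) (x : ℕ) =>
        popularAt H M t.2.1.unpair.2.unpair.2 t.2.1.unpair.1 t.2.2 x :=
      Computable.popularAt hHc (hs.comp Computable.fst) (hj.comp Computable.fst)
        (hv.comp Computable.fst) Computable.snd
    exact ((((Computable.decide_lt hi hj).and
      (Computable.decide_le (Computable.const i₀) hj)).and
      ((Computable.changesAt hA.computable).comp hj hT)).and
      (Computable.decide_eq (hB.computable.comp (hT.add (Computable.const 1))
        (Computable.two_pow (hj.add (Computable.const 1)))) hv)).and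
      (Computable.decide_le (Computable.const l) (Computable.boolCount hp
        ((hA.computable.comp hs hj).add (Computable.const 1))))
  · have hk : Computable fun t : ℕ × ℕ => t.2 := Computable.snd
    exact ((hA.computable.comp hk.unpair_snd.unpair_snd hk.unpair_fst).div
      (Computable.two_pow (hk.unpair_fst.sub (Computable.fst.add (Computable.const 1))))).mod
        (Computable.const 2)
  · intro i
    obtain ⟨j, hj, ⟨T, hT⟩, hl⟩ := hge (max (i + 1) i₀)
    obtain ⟨s₀, hs₀⟩ := hA.settles j
    have hev : ∀ᶠ s in Filter.atTop, ∀ x ∈ Q j,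
        popularAt H M s j (digitsVal β (2 ^ (j + 1))) x = true :=
      (Finset.eventually_all _).2 fun x hx =>
        eventually_popularAt hHm hH (Finset.mem_filter.1 hx).2
    obtain ⟨s, hs, hss⟩ := (hev.and (Filter.eventually_ge_atTop s₀)).exists
    refine ⟨Nat.pair j (Nat.pair T s), ?_⟩
    have hcount : l ≤ boolCount (popularAt H M s j (digitsVal β (2 ^ (j + 1)))) (A s j + 1) := by
      rw [boolCount_eq_card, hA.eq_of_le hs₀ hss]
      refine hl.trans (Finset.card_le_card fun x hx => ?_)
      exact Finset.mem_filter.2 ⟨(Finset.mem_filter.1 hx).1, hs x hx⟩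
    have h1 : i < j := lt_of_lt_of_le (Nat.lt_succ_self i) ((le_max_left _ _).trans hj)
    have h2 : i₀ ≤ j := (le_max_right _ _).trans hj
    simp [h1, h2, hT.1, hT.2, hcount]
  · intro i k hk
    generalize hj : k.unpair.1 = j at *
    generalize hT : k.unpair.2.unpair.1 = T at *
    generalize hs : k.unpair.2.unpair.2 = s at *
    simp only [Bool.and_eq_true, decide_eq_true_eq] at hk
    obtain ⟨⟨⟨⟨h1, h2⟩, h3⟩, h4⟩, h5⟩ := hk
    have hlc : LateChange A B β j T := ⟨h3, h4⟩
    rw [boolCount_eq_card] at h5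
    have hsub : ((Finset.range (A s j + 1)).filter fun x =>
        popularAt H M s j (digitsVal β (2 ^ (j + 1))) x = true) ⊆ Q j := by
      intro x hx
      obtain ⟨hx1, hx2⟩ := Finset.mem_filter.1 hx
      have := hA.le s j
      have hx1 := Finset.mem_range.1 hx1
      exact Finset.mem_filter.2 ⟨Finset.mem_range.2 (by omega), isPopular_of_popularAt hH hx2⟩
    -- The stage-`s` set lies in `Q j` and has at least `l` elements, while `Q j` has at most `l`.
    -- So it is all of `Q j`, including `α_j`, which forces `α_j ≤ A s j`.
    have heq := Finset.eq_of_subset_of_card_le hsub ((hle j h2 ⟨T, hlc⟩).trans h5)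
    have hmem : digitsVal α j ∈ Q j :=
      Finset.mem_filter.2 ⟨Finset.mem_range.2 (Nat.lt_succ_self _), hM j T hlc⟩
    rw [← heq] at hmem
    have h6 := Finset.mem_range.1 (Finset.mem_filter.1 hmem).1
    have h7 : A s j = digitsVal α j := le_antisymm (hA.le s j) (Nat.le_of_lt_succ h6)
    rw [h7, digitsVal_div α h1, binDigit_toNat]

/-- Conditional complexity bounded by the withheld complexity implies Turing reducibility. -/
theorem IsUniversalOptimal.computableFrom {U : List Bool → List Bool →. List Bool}
    (hU : IsUniversalOptimal U) {α β : ℝ} (hα : IsLeftCE α) (hβ : IsLeftCE β) {d : ℕ}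
    (hd : ∀ n, condC U (initSeg α n) (initSeg β n) ≤ withheldC U β n + d) :
    ComputableFrom α β := by
  obtain ⟨A, hA⟩ := hα.exists_digitApprox
  obtain ⟨B, hB⟩ := hβ.exists_digitApprox
  by_cases h : ∀ m, ∃ j, m ≤ j ∧ ∃ T, LateChange A B β j T
  · exact computableFrom_of_lateChanges hU hA hB hd h
  · push Not at h
    obtain ⟨j₁, h⟩ := h
    exact computableFrom_of_no_lateChange hA hB h

/-- Since an arbitrary constant is allowed in the second part, every computable `D` works in the
first part; we take one that grows with the lengths of both programs. -/
theorem mainTheorem9 (U : List Bool → List Bool →. List Bool) (hU : IsUniversalOptimal U) :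
    (∃ D : ℕ → ℕ → ℕ, Computable₂ D ∧
      ∀ (α β : ℝ) (Pα Pβ : List Bool), IsProgramFor U Pα α → IsProgramFor U Pβ β →
        (∀ n, condC U (initSeg α n) (initSeg β n) ≤
          withheldC U β n + D Pα.length Pβ.length) →
        ComputableFrom α β) ∧
    (∀ α β : ℝ, IsLeftCE α → IsLeftCE β →
      (∃ d : ℕ, ∀ n, condC U (initSeg α n) (initSeg β n) ≤ withheldC U β n + d) →
      ComputableFrom α β) := by
  refine ⟨⟨fun a b => a + b, Primrec.nat_add.to_comp, fun α β Pα Pβ hα hβ hd => ?_⟩,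
    fun α β hα hβ ⟨d, hd⟩ => hU.computableFrom hα hβ hd⟩
  exact hU.computableFrom (hα.isLeftCE hU.partrec) (hβ.isLeftCE hU.partrec) hd
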